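/- Consider the one-sorted first-order language (the objects are points) with constants $\alpha,\beta,\gamma$; function symbols ("constructions") $ext(ab,cd)$, $cb(d,abc)$, $ats(abc,def)$, $mid(a,b)$ of arities $4,4,6,2$; and relation symbols $B(a,b,c)$ ($b$ lies between $a$ and $c$), $SO(abc,def)$ (the ordered angles $abc$, $def$ have the same orientation), $ab\cong cd$ (congruence of segments) and $abc\cong def$ (congruence of angles). Abbreviate: - $L(a,b,c)$: $B(a,b,c)\lor B(a,c,b)\lor B(b,a,c)$; - $\widetilde L(a,b,c)$: $L(a,b,c)\lor a=b\lor b=c\lor a=c$; - $T(a,b,c)$: $\lnot L(a,b,c)$ and $a,b,c$ are pairwise distinct; - $SD(a,b,c)$: $B(a,b,c)\lor B(a,c,b)\lor(a\ne b\land c=b)\lor(a=b\land c\ne b)$; - $OO(abc,def)$: $\lnot SO(abc,def)\land T(a,b,c)\land T(d,e,f)$; - $SS(c,d,ab)$: $SO(abc,abd)$. Let $\Sigma$ be the theory with the following axioms (all variables universally quantified). Order and incidence: 1. $B(a,b,c)\to a\neq b\land a\ne c$; 2. $B(a,b,c)\to B(c,b,a)$; 3. $\lnot(B(a,b,c)\land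 B(a,c,b))$; 4. $L(a,b,c)\land L(a,b,d)\land c\neq d\to L(a,c,d)$; 5. $T(\alpha,\beta,\gamma)$. Orientation and crossbow: 6. $SO(abc,def)\to T(a,b,c)\land T(d,e,f)$; 7. $T(a,b,c)\to SO(abc,abc)$; 8. $SO(abc,def)\land SO(abc,ghi)\to SO(def,ghi)$; 9. $T(a,b,c)\land SD(b,a,e)\to SO(abc,ebc)$; 10. $T(a,b,c)\to OO(abc,cba)$; 11. $OO(abc,def)\land OO(def,ghi)\to SO(abc,ghi)$; 12. $B(a,b,c)\land T(a,c,d)\to OO(dba,dbc)$; 13. $OO(dba,dbc)\to\widetilde L(b,cb(d,abc),d)\land B(a,cb(d,abc),c)$; 14. $T(a,b,c)\to OO(abc,bac)$. Segment congruence: 15. $ab\cong ab$ and $ab\cong ba$; 16. $a\ne b\to b\,ext(ab,cd)\cong cd$; 17. $a\neq b\land c\ne d\to B(a,b,ext(ab,cd))$; 18. $(B(a,b,x)\lor b=x)\land bx\cong cd\to x=ext(ab,cd)$; 19. $ab\cong cd\land ab\cong ef\to cd\cong ef$; 20. $B(a,b,c)\land B(d,e,f)\land ab\cong de\land bc\cong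 ef\to ac\cong df$. Angle congruence: 21. $abc\cong def\to T(a,b,c)\land T(d,e,f)$; 22. if $T(a,b,c)$, $T(d,e,f)$ and $x=ats(abc,def)$, then $abc\cong dex$, $SS(x,f,de)$ and $bc\cong ex$; 23. $abc\cong dex\land SS(f,x,de)\land bc\cong ex\to x=ats(abc,def)$; 24. $SD(b,c,d)\land T(a,b,c)\to abc\cong abd$; 25. $T(a,b,c)\to abc\cong abc\land abc\cong cba$; 26. $abc\cong def\land abc\cong ghi\to def\cong ghi$; 27. $T(a,b,c)\land T(d,e,f)\land ab\cong de\land ac\cong df\land bac\cong edf\to abc\cong def$. Midpoints: 28. if $a\ne b$ and $m=mid(a,b)$, then $B(a,m,b)$ and $am\cong bm$; 29. $mid(a,a)=a$; 30. $mid(mid(a,b),mid(c,d))=mid(mid(a,c),mid(b,d))$. A uniform (case-free) construction of a point from $a$ and $b$ is a term of this language in the variables $a,b$ (so it may use the constants $\alpha,\beta,\gamma$). **Theorem.** There is a uniform construction trisecting segments: there are two terms $s(a,b)$ and $t(a,b)$, fixed once and for all, such that in every model of $\Sigma$ and for all points $a\neq b$ of it, the points $c=s(a,b)$ and $d=t(a,b)$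 satisfy $$B(a,c,d),\qquad B(c,d,b),\qquad ac\cong cd\cong db .$$ -/

import Mathlib

namespace FinGeom

/-- Function symbols (primitive constructions) of the language of plane geometry: three constant
points, segment extension, the crossbow construction, angle transport and the midpoint. -/
inductive Constr : ℕ → Type
  | alpha : Constr 0
  | beta : Constr 0
  | gamma : Constr 0
  | ext : Constr 4
  | cb : Constr 4
  | ats : Constr 6
  | mid : Constr 2

/-- Relation symbols: betweenness, same orientation of two ordered angles, congruence of
segments, congruence of angles. -/
inductive Rel : ℕ → Type
  | btw : Rel 3
  | sameOrient : Rel 6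
  | segCong : Rel 4
  | angCong : Rel 6

/-- The one-sorted (points only) first-order language of the theory. Its terms in the variables
`a`, `b` are exactly the uniform, case-free constructions starting from `a` and `b`. -/
def geoLang : FirstOrder.Language := ⟨Constr, Rel⟩

section Primitives

variable {P : Type*} [geoLang.Structure P]

/-- `B a b c`: the point `b` lies strictly between `a` and `c`. -/
def B (a b c : P) : Prop :=
  FirstOrder.Language.Structure.RelMap (L := geoLang) Rel.btw ![a, b, c]

/-- `SO a b c d e f`: the ordered angles `abc` and `def` have the same orientation. -/
def SO (a b c d e f : P) : Prop :=
  FirstOrder.Language.Structure.RelMap (L := geoLang) Rel.sameOrient ![a, b, c, d, e, f]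

/-- `C a b c d`: the segments `ab` and `cd` are congruent. -/
def C (a b c d : P) : Prop :=
  FirstOrder.Language.Structure.RelMap (L := geoLang) Rel.segCong ![a, b, c, d]

/-- `AC a b c d e f`: the angles `abc` and `def` are congruent. -/
def AC (a b c d e f : P) : Prop :=
  FirstOrder.Language.Structure.RelMap (L := geoLang) Rel.angCong ![a, b, c, d, e, f]

variable (P) in
/-- The constant point `α`. -/
def ptAlpha : P := FirstOrder.Language.Structure.funMap (L := geoLang) Constr.alpha ![]

variable (P) in
/-- The constant point `β`. -/
def ptBeta : P := FirstOrder.Language.Structure.funMap (L := geoLang) Constr.beta ![]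

variable (P) in
/-- The constant point `γ`. -/
def ptGamma : P := FirstOrder.Language.Structure.funMap (L := geoLang) Constr.gamma ![]

/-- `ext(ab, cd)`: extension of the segment `ab` beyond `b` by the length of `cd`. -/
def ext (a b c d : P) : P :=
  FirstOrder.Language.Structure.funMap (L := geoLang) Constr.ext ![a, b, c, d]

/-- The crossbow construction `cb(d, abc)`. -/
def cb (d a b c : P) : P :=
  FirstOrder.Language.Structure.funMap (L := geoLang) Constr.cb ![d, a, b, c]

/-- Angle transport to the same side, `ats(abc, def)`. -/
def ats (a b c d e f : P) : P :=
  FirstOrder.Language.Structure.funMap (L := geoLang) Constr.ats ![a, b, c, d, e, f]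

/-- The midpoint construction `mid(a, b)`. -/
def mid (a b : P) : P :=
  FirstOrder.Language.Structure.funMap (L := geoLang) Constr.mid ![a, b]

/-- Three (necessarily distinct) collinear points. -/
def L (a b c : P) : Prop := B a b c ∨ B a c b ∨ B b a c

/-- Non-strict collinearity. -/
def Lt (a b c : P) : Prop := L a b c ∨ a = b ∨ b = c ∨ a = c

/-- Three distinct, non-collinear points. -/
def T (a b c : P) : Prop := ¬ L a b c ∧ a ≠ b ∧ b ≠ c ∧ a ≠ c

/-- `b` and `c` are in the same direction from `a`. -/
def SD (a b c : P) : Prop :=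
  B a b c ∨ B a c b ∨ (a ≠ b ∧ c = b) ∨ (a = b ∧ c ≠ b)

/-- The angles `abc` and `def` have opposite orientations. -/
def OO (a b c d e f : P) : Prop := ¬ SO a b c d e f ∧ T a b c ∧ T d e f

/-- `SS c d a b`: the points `c` and `d` are on the same side of the segment `ab`. -/
def SS (c d a b : P) : Prop := SO a b c a b d

end Primitives

/-- The axioms of the quantifier-free theory of the (flat) plane: order, incidence, angle
orientation and crossbow, congruence, midpoints, and bisymmetry of the midpoint construction. -/
structure FlatPlane (P : Type*) [geoLang.Structure P] : Prop where
  -- order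
  btw_ne : ∀ a b c : P, B a b c → a ≠ b ∧ a ≠ c
  btw_symm : ∀ a b c : P, B a b c → B c b a
  btw_unique : ∀ a b c : P, ¬ (B a b c ∧ B a c b)
  -- incidence
  line_unique : ∀ a b c d : P, L a b c → L a b d → c ≠ d → L a c d
  triangle : T (ptAlpha P) (ptBeta P) (ptGamma P)
  -- orientation and crossbow
  so_triangle : ∀ a b c d e f : P, SO a b c d e f → T a b c ∧ T d e f
  so_refl : ∀ a b c : P, T a b c → SO a b c a b c
  so_trans : ∀ a b c d e f g h i : P,
    SO a b c d e f → SO a b c g h i → SO d e f g h i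
  so_ray : ∀ a b c e : P, T a b c → SD b a e → SO a b c e b c
  oo_reverse : ∀ a b c : P, T a b c → OO a b c c b a
  oo_oo_so : ∀ a b c d e f g h i : P,
    OO a b c d e f → OO d e f g h i → SO a b c g h i
  oo_of_btw : ∀ a b c d : P, B a b c → T a c d → OO d b a d b c
  crossbow : ∀ a b c d : P, OO d b a d b c → Lt b (cb d a b c) d ∧ B a (cb d a b c) c
  oo_triangle : ∀ a b c : P, T a b c → OO a b c b a c
  -- segment congruence
  seg_refl : ∀ a b : P, C a b a b ∧ C a b b a
  ext_cong : ∀ a b c d : P, a ≠ b → C b (ext a b c d) c d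
  ext_btw : ∀ a b c d : P, a ≠ b → c ≠ d → B a b (ext a b c d)
  ext_unique : ∀ a b c d x : P, (B a b x ∨ b = x) → C b x c d → x = ext a b c d
  seg_trans : ∀ a b c d e f : P, C a b c d → C a b e f → C c d e f
  seg_add : ∀ a b c d e f : P, B a b c → B d e f → C a b d e → C b c e f → C a c d f
  -- angle congruence
  ang_triangle : ∀ a b c d e f : P, AC a b c d e f → T a b c ∧ T d e f
  ats_spec : ∀ a b c d e f : P, T a b c → T d e f →
    AC a b c d e (ats a b c d e f) ∧ SS (ats a b c d e f) f d e ∧ C b c e (ats a b c d e f)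
  ats_unique : ∀ a b c d e f x : P,
    AC a b c d e x → SS f x d e → C b c e x → x = ats a b c d e f
  ang_ray : ∀ a b c d : P, SD b c d → T a b c → AC a b c a b d
  ang_refl : ∀ a b c : P, T a b c → AC a b c a b c ∧ AC a b c c b a
  ang_trans : ∀ a b c d e f g h i : P,
    AC a b c d e f → AC a b c g h i → AC d e f g h i
  sas : ∀ a b c d e f : P, T a b c → T d e f → C a b d e → C a c d f →
    AC b a c e d f → AC a b c d e f
  -- midpoints
  mid_spec : ∀ a b : P, a ≠ b → B a (mid a b) b ∧ C a (mid a b) b (mid a b)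
  mid_self : ∀ a : P, mid a a = a
  mid_bisymm : ∀ a b c d : P,
    mid (mid a b) (mid c d) = mid (mid a c) (mid b d)

end FinGeom

namespace FinGeom

section Plane

variable {P : Type*} [geoLang.Structure P]

theorem T_iff_not_Lt {a b c : P} : T a b c ↔ ¬ Lt a b c := by
  unfold T Lt
  tauto

theorem B.lt {a b c : P} (hb : B a b c) : Lt a b c := Or.inl (Or.inl hb)

namespace FlatPlane

/-! ### Incidence -/

theorem ne_of_btw (h : FlatPlane P) {a b c : P} (hb : B a b c) : a ≠ b ∧ b ≠ c ∧ a ≠ c :=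
  ⟨(h.btw_ne _ _ _ hb).1, (h.btw_ne _ _ _ (h.btw_symm _ _ _ hb)).1.symm, (h.btw_ne _ _ _ hb).2⟩

theorem L_swap (h : FlatPlane P) {a b c : P} (hl : L a b c) : L b a c := by
  rcases hl with hl | hl | hl
  · exact Or.inr (Or.inr hl)
  · exact Or.inr (Or.inl (h.btw_symm _ _ _ hl))
  · exact Or.inl hl

theorem L_rotate (h : FlatPlane P) {a b c : P} (hl : L a b c) : L b c a := by
  rcases hl with hl | hl | hl
  · exact Or.inr (Or.inr (h.btw_symm _ _ _ hl))
  · exact Or.inl (h.btw_symm _ _ _ hl)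
  · exact Or.inr (Or.inl hl)

theorem Lt_swap (h : FlatPlane P) {a b c : P} (hl : Lt a b c) : Lt b a c := by
  rcases hl with hl | rfl | rfl | rfl
  · exact Or.inl (h.L_swap hl)
  · exact Or.inr (Or.inl rfl)
  · exact Or.inr (Or.inr (Or.inr rfl))
  · exact Or.inr (Or.inr (Or.inl rfl))

theorem Lt_rotate (h : FlatPlane P) {a b c : P} (hl : Lt a b c) : Lt b c a := by
  rcases hl with hl | rfl | rfl | rfl
  · exact Or.inl (h.L_rotate hl)
  · exact Or.inr (Or.inr (Or.inr rfl))
  · exact Or.inr (Or.inl rfl)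
  · exact Or.inr (Or.inr (Or.inl rfl))

theorem Lt_swap_right (h : FlatPlane P) {a b c : P} (hl : Lt a b c) : Lt a c b :=
  h.Lt_rotate (h.Lt_swap hl)

theorem T_swap (h : FlatPlane P) {a b c : P} (ht : T a b c) : T b a c :=
  T_iff_not_Lt.2 fun hl => T_iff_not_Lt.1 ht (h.Lt_swap hl)

theorem T_rotate (h : FlatPlane P) {a b c : P} (ht : T a b c) : T b c a :=
  T_iff_not_Lt.2 fun hl => T_iff_not_Lt.1 ht (h.Lt_rotate (h.Lt_rotate hl))

theorem Lt_of_Lt_Lt (h : FlatPlane P) {a b x y : P} (hab : a ≠ b) (hx : Lt a b x)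
    (hy : Lt a b y) : Lt a x y := by
  by_cases hxy : x = y
  · exact Or.inr (Or.inr (Or.inl hxy))
  rcases hx with hx' | hx' | rfl | rfl
  · rcases hy with hy' | hy' | rfl | rfl
    · exact Or.inl (h.line_unique _ _ _ _ hx' hy' hxy)
    · exact absurd hy' hab
    · exact Or.inl (h.L_swap (h.L_rotate (h.L_rotate hx')))
    · exact Or.inr (Or.inr (Or.inr rfl))
  · exact absurd hx' hab
  · exact hy
  · exact Or.inr (Or.inl rfl)

/-- Three points of one line are collinear. -/
theorem Lt_of_mem_line (h : FlatPlane P) {a b x y z : P} (hab : a ≠ b) (hx : Lt a b x)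
    (hy : Lt a b y) (hz : Lt a b z) : Lt x y z := by
  by_cases hax : a = x
  · subst hax
    exact h.Lt_of_Lt_Lt hab hy hz
  · exact h.Lt_of_Lt_Lt (Ne.symm hax) (h.Lt_swap (h.Lt_of_Lt_Lt hab hx hy))
      (h.Lt_swap (h.Lt_of_Lt_Lt hab hx hz))

theorem Lt_left (a b : P) : Lt a b a := Or.inr (Or.inr (Or.inr rfl))

theorem Lt_right (a b : P) : Lt a b b := Or.inr (Or.inr (Or.inl rfl))

/-- The line through two points of the line `ab` is contained in the line `ab`. -/
theorem Lt_of_line_eq (h : FlatPlane P) {a b x y z : P} (hab : a ≠ b) (hxy : x ≠ y)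
    (hx : Lt a b x) (hy : Lt a b y) (hz : Lt x y z) : Lt a b z :=
  h.Lt_of_mem_line hxy (h.Lt_of_mem_line hab hx hy (Lt_left a b))
    (h.Lt_of_mem_line hab hx hy (Lt_right a b)) hz

theorem exists_T (h : FlatPlane P) {a b : P} (hab : a ≠ b) : ∃ f : P, T a b f := by
  by_contra! hn
  have hn' : ∀ f : P, Lt a b f := fun f => by
    by_contra hf
    exact hn f (T_iff_not_Lt.2 hf)
  exact T_iff_not_Lt.1 h.triangle (h.Lt_of_mem_line hab (hn' _) (hn' _) (hn' _))

theorem mid_Lt (h : FlatPlane P) {a b x y : P} (hab : a ≠ b) (hx : Lt a b x) (hy : Lt a b y) :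
    Lt a b (mid x y) := by
  by_cases hxy : x = y
  · rw [hxy, h.mid_self]
    exact hy
  · exact h.Lt_of_line_eq hab hxy hx hy
      (h.Lt_swap_right (h.mid_spec x y hxy).1.lt)

/-! ### Orientation -/

section Orientation

variable {a b c d e f g i j : P}

theorem SO_symm (h : FlatPlane P) (hs : SO a b c d e f) : SO d e f a b c :=
  h.so_trans _ _ _ _ _ _ _ _ _ hs (h.so_refl _ _ _ (h.so_triangle _ _ _ _ _ _ hs).1)

theorem OO_symm (h : FlatPlane P) (ho : OO a b c d e f) : OO d e f a b c :=
  ⟨fun hs => ho.1 (h.SO_symm hs), ho.2.2, ho.2.1⟩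

theorem OO_of_OO_SO (h : FlatPlane P) (ho : OO a b c d e f) (hs : SO d e f g i j) :
    OO a b c g i j :=
  ⟨fun hs' => ho.1 (h.so_trans _ _ _ _ _ _ _ _ _ (h.SO_symm hs') (h.SO_symm hs)),
    ho.2.1, (h.so_triangle _ _ _ _ _ _ hs).2⟩

theorem OO_ray (h : FlatPlane P) (ho : OO f b a f b c) (hd : SD b c d) : OO f b a f b d := by
  have hcbf : T c b f := h.T_swap (h.T_rotate ho.2.2)
  have hs := h.so_ray c b f d hcbf hd
  have hd' := h.oo_reverse _ _ _ (h.so_triangle _ _ _ _ _ _ hs).2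
  exact h.OO_of_OO_SO ho (h.oo_oo_so _ _ _ _ _ _ _ _ _
    (h.OO_of_OO_SO (h.oo_reverse _ _ _ ho.2.2) hs) hd')

theorem btw_of_OO (h : FlatPlane P) (ho : OO f b a f b c) (hl : Lt a b c) : B a b c := by
  obtain ⟨hx, hb⟩ := h.crossbow a b c f ho
  suffices hxb : cb f a b c = b by rwa [hxb] at hb
  by_contra hxb
  have hac := (h.ne_of_btw hb).2.2
  have hbx : Lt b (cb f a b c) a := h.Lt_of_mem_line hac (h.Lt_swap_right hl)
    (h.Lt_swap_right hb.lt) (Lt_left a c)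
  exact T_iff_not_Lt.1 ho.2.1 (h.Lt_of_mem_line (Ne.symm hxb) hx (Lt_left _ _) hbx)

end Orientation

/-! ### Order on a line -/

section Order

variable {a b c d : P}

theorem btw_ray (h : FlatPlane P) (hb : B a b c) (hd : SD b c d) : B a b d := by
  obtain ⟨hab, hbc, hac⟩ := h.ne_of_btw hb
  obtain ⟨f, hf⟩ := h.exists_T hac
  have hl : Lt b c d := by
    rcases hd with hd | hd | ⟨-, rfl⟩ | ⟨hd, -⟩
    · exact hd.lt
    · exact Or.inl (Or.inr (Or.inl hd))
    · exact Lt_right _ _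
    · exact absurd hd hbc
  exact h.btw_of_OO (h.OO_ray (h.oo_of_btw _ _ _ _ hb hf) hd)
    (h.Lt_of_mem_line hbc (h.Lt_rotate hb.lt) (Lt_left _ _) hl)

theorem btw_outer (h : FlatPlane P) (h₁ : B a b c) (h₂ : B b c d) : B a b d :=
  h.btw_ray h₁ (Or.inl h₂)

theorem btw_outer' (h : FlatPlane P) (h₁ : B a b c) (h₂ : B b c d) : B a c d :=
  h.btw_symm _ _ _ (h.btw_outer (h.btw_symm _ _ _ h₂) (h.btw_symm _ _ _ h₁))

theorem btw_inner (h : FlatPlane P) (h₁ : B a b d) (h₂ : B a d c) : B b d c :=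
  h.btw_symm _ _ _ (h.btw_ray (h.btw_symm _ _ _ h₂) (Or.inr (Or.inl (h.btw_symm _ _ _ h₁))))

end Order

/-! ### Congruence of segments -/

section Congruence

variable {a b c d e f : P}

theorem C_symm (h : FlatPlane P) (hc : C a b c d) : C c d a b :=
  h.seg_trans _ _ _ _ _ _ hc (h.seg_refl a b).1

theorem C_trans (h : FlatPlane P) (h₁ : C a b c d) (h₂ : C c d e f) : C a b e f :=
  h.seg_trans _ _ _ _ _ _ (h.C_symm h₁) h₂

theorem C_flip_right (h : FlatPlane P) (hc : C a b c d) : C a b d c :=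
  h.C_trans hc (h.seg_refl c d).2

end Congruence

/-! ### Trisection of a median -/

/-- In the triangle `uvw`, the median `vq` meets the median `up` in a point `g` which, together
with the midpoint of `ug`, trisects `up`. -/
theorem median_trisect (h : FlatPlane P) {u v w : P} (ht : T u v w) {p q g m : P}
    (hp : p = mid w v) (hq : q = mid u w) (hg : g = cb q u v p) (hm : m = mid u g) :
    B u m g ∧ B m g p ∧ C u m m g ∧ C m g g p := by
  have huv : u ≠ v := ht.2.1
  have hvw : v ≠ w := ht.2.2.1
  have huw : u ≠ w := ht.2.2.2
  have hp' : B w p v := hp ▸ (h.mid_spec w v hvw.symm).1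
  have hq' : B u q w := hq ▸ (h.mid_spec u w huw).1
  have hopp : OO q v u q v p := by
    have h₁ := h.oo_of_btw u q w v hq' (h.T_rotate (h.T_swap ht))
    have h₂ := h.oo_triangle _ _ _ h₁.2.1
    have h₃ := h.oo_triangle _ _ _ h₁.2.2
    have h₄ := h.oo_oo_so _ _ _ _ _ _ _ _ _ (h.OO_symm h₂) h₁
    have h₅ : OO q v u q v w := ⟨fun hs => h₃.1 (h.so_trans _ _ _ _ _ _ _ _ _ h₄ hs),
      h₂.2.2, h₃.2.2⟩
    exact h.OO_ray h₅ (Or.inr (Or.inl (h.btw_symm _ _ _ hp')))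
  obtain ⟨hgl, hgb⟩ := h.crossbow u v p q hopp
  rw [← hg] at hgl hgb
  obtain ⟨hug, hgp, hup⟩ := h.ne_of_btw hgb
  have hqv : q ≠ v := hopp.2.1.2.1
  have hum := h.mid_spec u g hug
  rw [← hm] at hum
  have hmgp : B m g p := h.btw_inner hum.1 hgb
  have hmp := (h.ne_of_btw hmgp).2.2
  have hug' : Lt u p g := h.Lt_swap_right hgb.lt
  have hgq : Lt q v g := h.Lt_rotate (h.Lt_rotate hgl)
  have hx₁ : Lt u p (mid m p) :=
    h.mid_Lt hup (hm ▸ h.mid_Lt hup (Lt_left _ _) hug') (Lt_right _ _)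
  have hx₂ : Lt q v (mid m p) := by
    have hbi := h.mid_bisymm u g w v
    rw [← hm, ← hp, ← hq] at hbi
    rw [hbi]
    exact h.mid_Lt hqv (Lt_left _ _) (h.mid_Lt hqv hgq (Lt_right _ _))
  have hx : mid m p = g := by
    by_contra hne
    refine T_iff_not_Lt.1 hopp.2.1 (h.Lt_of_line_eq hqv hne hx₂ hgq ?_)
    exact h.Lt_of_mem_line hup hx₁ hug' (Lt_left _ _)
  have hmp' := h.mid_spec m p hmp
  rw [hx] at hmp'
  exact ⟨hum.1, hmgp, h.C_flip_right hum.2, h.C_flip_right hmp'.2⟩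

/-- A trisection of one segment can be transported to a congruent segment. -/
theorem trisect_of_congruent (h : FlatPlane P) {a b u m g p : P} (hab : a ≠ b)
    (h₁ : B u m g) (h₂ : B m g p) (h₃ : C u m m g) (h₄ : C m g g p) (hup : C u p a b)
    {c d : P} (hc : c = ext (ext b a a b) a u m) (hd : d = ext a c u m) :
    B a c d ∧ B c d b ∧ C a c c d ∧ C c d d b := by
  have hum : u ≠ m := (h.ne_of_btw h₁).1
  have hb' : B b a (ext b a a b) := h.ext_btw _ _ _ _ hab.symm hab
  have hb'a := (h.ne_of_btw hb').2.1.symm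
  have hac : B (ext b a a b) a c := hc ▸ h.ext_btw _ _ _ _ hb'a hum
  have hcac : C a c u m := hc ▸ h.ext_cong _ _ _ _ hb'a
  have hac' := (h.ne_of_btw hac).2.1
  have hacd : B a c d := hd ▸ h.ext_btw _ _ _ _ hac' hum
  have hccd : C c d u m := hd ▸ h.ext_cong _ _ _ _ hac'
  have hcd := (h.ne_of_btw hacd).2.1
  have hcde : B c d (ext c d u m) := h.ext_btw _ _ _ _ hcd hum
  have hcede : C d (ext c d u m) u m := h.ext_cong _ _ _ _ hcd
  have hade := h.btw_outer' hacd hcde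
  have hb'e := h.btw_outer (h.btw_outer hac hacd) hade
  have hcad : C a d u g := h.seg_add _ _ _ _ _ _ hacd h₁ hcac (h.C_trans hccd h₃)
  have hcae : C a (ext c d u m) u p := h.seg_add _ _ _ _ _ _ hade (h.btw_outer' h₁ h₂) hcad
    (h.C_trans hcede (h.C_trans h₃ h₄))
  have heb : ext c d u m = b :=
    (h.ext_unique _ _ _ _ _ (Or.inl hb'e) (h.C_trans hcae hup)).trans
      (h.ext_unique _ _ _ _ _ (Or.inl (h.btw_symm _ _ _ hb')) (h.seg_refl a b).1).symm
  rw [heb] at hcde hcede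
  exact ⟨hacd, hcde, h.C_trans hcac (h.C_symm hccd), h.C_trans hccd (h.C_symm hcede)⟩

/-- Extending the median of `αβγ` from `β` yields a triangle over `γα`. -/
theorem T_ext_median (h : FlatPlane P) {a b : P} (hab : a ≠ b) :
    T (ext (ptBeta P) (mid (ptAlpha P) (ptGamma P)) a b) (ptGamma P) (ptAlpha P) ∧
    C (ext (ptBeta P) (mid (ptAlpha P) (ptGamma P)) a b) (mid (ptAlpha P) (ptGamma P)) a b := by
  have ht := h.triangle
  set p := mid (ptAlpha P) (ptGamma P) with hp
  have hac : ptAlpha P ≠ ptGamma P := ht.2.2.2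
  have hpb : B (ptAlpha P) p (ptGamma P) := (h.mid_spec _ _ hac).1
  have hlp : Lt (ptAlpha P) (ptGamma P) p := h.Lt_swap_right hpb.lt
  have hne : ptBeta P ≠ p := by
    intro he
    rw [← he] at hpb
    exact ht.1 (Or.inl hpb)
  have hb := h.ext_btw _ _ _ _ hne hab
  have hc := h.ext_cong _ _ a b hne
  set u := ext (ptBeta P) p a b
  refine ⟨T_iff_not_Lt.2 fun hl => T_iff_not_Lt.1 ht ?_,
    h.C_trans (h.seg_refl u p).2 hc⟩
  have hlu : Lt (ptAlpha P) (ptGamma P) u := h.Lt_swap (h.Lt_rotate hl)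
  have hβ : Lt (ptAlpha P) (ptGamma P) (ptBeta P) :=
    h.Lt_of_line_eq hac (h.ne_of_btw hb).2.1 hlp hlu (h.Lt_rotate hb.lt)
  exact h.Lt_swap_right hβ

end FlatPlane

end Plane

/-! ### Terms -/

open FirstOrder.Language

/-- The term `ext(st, uv)`. -/
def extTerm {n : Type*} (s t u v : geoLang.Term n) : geoLang.Term n :=
  Term.func (L := geoLang) Constr.ext ![s, t, u, v]

/-- The term `cb(s, tuv)`. -/
def cbTerm {n : Type*} (s t u v : geoLang.Term n) : geoLang.Term n :=
  Term.func (L := geoLang) Constr.cb ![s, t, u, v]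

/-- The term `mid(s, t)`. -/
def midTerm {n : Type*} (s t : geoLang.Term n) : geoLang.Term n :=
  Term.func (L := geoLang) Constr.mid ![s, t]

/-- The term `α`. -/
def alphaTerm {n : Type*} : geoLang.Term n := Term.func (L := geoLang) Constr.alpha ![]

/-- The term `β`. -/
def betaTerm {n : Type*} : geoLang.Term n := Term.func (L := geoLang) Constr.beta ![]

/-- The term `γ`. -/
def gammaTerm {n : Type*} : geoLang.Term n := Term.func (L := geoLang) Constr.gamma ![]

section Realize

variable {P : Type*} [geoLang.Structure P] {n : Type*} (x : n → P) (s t u v : geoLang.Term n)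

@[simp]
theorem realize_extTerm : (extTerm s t u v).realize x =
    ext (s.realize x) (t.realize x) (u.realize x) (v.realize x) := by
  refine congrArg (Structure.funMap (L := geoLang) Constr.ext) (funext fun i => ?_)
  fin_cases i <;> rfl

@[simp]
theorem realize_cbTerm : (cbTerm s t u v).realize x =
    cb (s.realize x) (t.realize x) (u.realize x) (v.realize x) := by
  refine congrArg (Structure.funMap (L := geoLang) Constr.cb) (funext fun i => ?_)
  fin_cases i <;> rfl

@[simp]
theorem realize_midTerm : (midTerm s t).realize x = mid (s.realize x) (t.realize x) := by
  refine congrArg (Structure.funMap (L := geoLang) Constr.mid) (funext fun i => ?_)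
  fin_cases i <;> rfl

@[simp]
theorem realize_alphaTerm : (alphaTerm : geoLang.Term n).realize x = ptAlpha P :=
  congrArg (Structure.funMap (L := geoLang) Constr.alpha) (funext fun i => i.elim0)

@[simp]
theorem realize_betaTerm : (betaTerm : geoLang.Term n).realize x = ptBeta P :=
  congrArg (Structure.funMap (L := geoLang) Constr.beta) (funext fun i => i.elim0)

@[simp]
theorem realize_gammaTerm : (gammaTerm : geoLang.Term n).realize x = ptGamma P :=
  congrArg (Structure.funMap (L := geoLang) Constr.gamma) (funext fun i => i.elim0)

end Realize

/-- The midpoint of `αγ`. -/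
def footTerm : geoLang.Term (Fin 2) := midTerm alphaTerm gammaTerm

/-- The apex `u` of a triangle `uγα` whose median from `u` is congruent to `ab`. -/
def apexTerm : geoLang.Term (Fin 2) := extTerm betaTerm footTerm (Term.var 0) (Term.var 1)

/-- The centroid of the triangle `uγα`. -/
def centroidTerm : geoLang.Term (Fin 2) :=
  cbTerm (midTerm apexTerm alphaTerm) apexTerm gammaTerm footTerm

/-- The first trisection point of the segment `ab`. -/
def firstTrisectTerm : geoLang.Term (Fin 2) :=
  extTerm (extTerm (Term.var 1) (Term.var 0) (Term.var 0) (Term.var 1)) (Term.var 0)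
    apexTerm (midTerm apexTerm centroidTerm)

/-- The second trisection point of the segment `ab`. -/
def secondTrisectTerm : geoLang.Term (Fin 2) :=
  extTerm (Term.var 0) firstTrisectTerm apexTerm (midTerm apexTerm centroidTerm)

end FinGeom

theorem mainTheorem8 :
    ∃ s t : FinGeom.geoLang.Term (Fin 2),
      ∀ (P : Type*) [FinGeom.geoLang.Structure P], FinGeom.FlatPlane P →
        ∀ a b c d : P, a ≠ b → c = s.realize ![a, b] → d = t.realize ![a, b] →
          FinGeom.B a c d ∧ FinGeom.B c d b ∧ FinGeom.C a c c d ∧ FinGeom.C c d d b := by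
  refine ⟨FinGeom.firstTrisectTerm, FinGeom.secondTrisectTerm, fun P _ h a b c d hab hc hd => ?_⟩
  obtain ⟨ht, hup⟩ := h.T_ext_median hab
  obtain ⟨h₁, h₂, h₃, h₄⟩ := h.median_trisect ht rfl rfl rfl rfl
  refine h.trisect_of_congruent hab h₁ h₂ h₃ h₄ hup ?_ ?_
  · simpa [FinGeom.firstTrisectTerm, FinGeom.apexTerm, FinGeom.centroidTerm,
      FinGeom.footTerm] using hc
  · subst hc
    simpa [FinGeom.secondTrisectTerm, FinGeom.apexTerm, FinGeom.centroidTerm,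
      FinGeom.footTerm] using hd
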